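/- Let $X$ be a non-degenerate real random variable (that is, not almost surely constant) such that $\varphi(t):=\log \mathbb E[e^{tX}]$ is finite for all $t\ge 0$. Let $\{X_{i,j}: i,j\in\mathbb N\}$ be a two-dimensional array of independent copies of $X$, and let $\{N_n\}_{n\in\mathbb N}$ be a sequence of natural numbers such that $\lim_{n\to\infty} e^{-cn}N_n=1$ for some $c>0$. Set $$Z_n=\sum_{i=1}^{N_n}\prod_{j=1}^{n}e^{X_{i,j}},\qquad c_2:=2\varphi'(2)-\varphi(2).$$ Suppose that $c>c_2$. Then $Z_n$ is square integrable for every $n$, $\operatorname{Var} Z_n>0$ for all sufficiently large $n$, and $$\frac{Z_n-\mathbb E Z_n}{\sqrt{\operatorname{Var} Z_n}}\ \longrightarrow\ \mathcal N(0,1)\quad\text{in distribution, as } n\to\infty.$$ -/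

import Mathlib

open MeasureTheory ProbabilityTheory Filter Topology

noncomputable section

/-- The sum of `N n` products of `n` exponentials,
`Z_n = ∑_{i = 1}^{N n} ∏_{j = 1}^{n} exp (X_{i,j})`; rows and columns are numbered from `0`. -/
def sumOfProducts {Ω : Type*} (X : ℕ → ℕ → Ω → ℝ) (N : ℕ → ℕ) (n : ℕ) (ω : Ω) : ℝ :=
  ∑ i ∈ Finset.range (N n), ∏ j ∈ Finset.range n, Real.exp (X i j ω)

/-- The critical point `c₂ = 2 φ'(2) - φ(2)`, where `φ(t) = log E[exp (t X)]` is the log-moment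
generating function of `X` (in Mathlib, `cgf`). -/
def criticalPointTwo {Ω : Type*} [MeasurableSpace Ω] (X : Ω → ℝ) (P : Measure Ω) : ℝ :=
  2 * deriv (cgf X P) 2 - cgf X P 2

end

/-! `Z_n` is a sum of `N n` i.i.d. row products `W` with `E[W^t] = exp (n φ(t))`, so the claim
follows from Lyapunov's condition `N E|W - EW|^p / (N Var W)^(p/2) → 0` for a single `p ∈ (2, 3]`.
Non-degeneracy gives `E[e^X]^2 < E[e^(2X)]`, hence `Var W ~ exp (n φ(2))`. As `N n ~ exp (c n)`, the
Lyapunov ratio is at most a constant times `exp (n f(p))` with `f(p) = c (1 - p/2) + φ(p) - p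
φ(2)/2`. Here `f(2) = 0` and `f'(2) = (c₂ - c)/2 < 0`, so `p` slightly above `2` works
(`exists_lyapunov_exponent`). -/

/-! ### Characteristic functions and the Lyapunov theorem. -/

lemma Real.norm_cexp_mul_I_sub_taylor_two_le (x : ℝ) {p : ℝ} (hp2 : 2 ≤ p) (hp3 : p ≤ 3) :
    ‖Complex.exp (x * Complex.I) - (1 + x * Complex.I - x ^ 2 / 2)‖ ≤ 4 * |x| ^ p := by
  rcases le_or_gt |x| 1 with hx | hx
  · have h := Complex.exp_bound (x := x * Complex.I) (by simpa using hx) (n := 3) (by norm_num)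
    have hsum : ∑ m ∈ Finset.range 3, (x * Complex.I) ^ m / (m.factorial : ℂ) =
        1 + x * Complex.I - x ^ 2 / 2 := by
      simp [Finset.sum_range_succ, mul_pow]
      ring
    rw [hsum] at h
    refine h.trans ?_
    have h3 : |x| ^ (3 : ℕ) ≤ |x| ^ p := by
      rcases eq_or_ne x 0 with rfl | h0
      · simp [Real.rpow_nonneg]
      · rw [← Real.rpow_natCast]
        exact Real.rpow_le_rpow_of_exponent_ge (abs_pos.2 h0) hx (by simpa using hp3)
    have : ‖(x : ℂ) * Complex.I‖ = |x| := by simp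
    rw [this]
    norm_num [Nat.factorial]
    nlinarith [pow_nonneg (abs_nonneg x) 3]
  -- For `|x| > 1` the triangle inequality suffices: `1 + (1 + |x| + |x|^2/2) ≤ 4 |x|^2`.
  · have h2 : |x| ^ (2 : ℕ) ≤ |x| ^ p := by
      rw [← Real.rpow_natCast]
      exact Real.rpow_le_rpow_of_exponent_le hx.le (by simpa using hp2)
    have hb : ‖(1 : ℂ) + x * Complex.I - x ^ 2 / 2‖ ≤ 1 + |x| + |x| ^ 2 / 2 := by
      refine (norm_sub_le _ _).trans ?_
      gcongr
      · refine (norm_add_le _ _).trans ?_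
        simp
      · simp
    refine (norm_sub_le _ _).trans ?_
    rw [Complex.norm_exp_ofReal_mul_I]
    nlinarith

lemma ProbabilityTheory.norm_charFun_sub_taylor_two_le {Ω : Type*} [MeasurableSpace Ω]
    {P : Measure Ω} [IsProbabilityMeasure P] {Y : Ω → ℝ} (hY : MemLp Y 2 P) (hmean : ∫ ω, Y ω ∂P = 0)
    {p : ℝ} (hp2 : 2 ≤ p) (hp3 : p ≤ 3) (hYp : Integrable (fun ω ↦ |Y ω| ^ p) P) (t : ℝ) :
    ‖charFun (P.map Y) t - (1 - t ^ 2 * (∫ ω, Y ω ^ 2 ∂P : ℝ) / 2)‖ ≤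
      4 * |t| ^ p * ∫ ω, |Y ω| ^ p ∂P := by
  have hm : AEMeasurable Y P := hY.aestronglyMeasurable.aemeasurable
  have h1 : Integrable Y P := hY.integrable (by norm_num)
  have h2 : Integrable (fun ω ↦ Y ω ^ 2) P := hY.integrable_sq
  have hexp : Integrable (fun ω ↦ Complex.exp ((t * Y ω : ℝ) * Complex.I)) P := by
    refine Integrable.of_bound (C := 1) ?_ (.of_forall fun ω ↦ (Complex.norm_exp_ofReal_mul_I _).le)
    exact (Complex.measurable_exp.comp_aemeasurable
      ((Complex.measurable_ofReal.comp_aemeasurable (hm.const_mul t)).mul_const _)).aestronglyMeasurable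
  have hlin : Integrable (fun ω ↦ (((t * Y ω : ℝ) : ℂ) * Complex.I)) P :=
    ((h1.const_mul t).ofReal (𝕜 := ℂ)).mul_const _
  have hquad : Integrable (fun ω ↦ (((t * Y ω : ℝ) : ℂ) ^ 2 / 2)) P := by
    have := ((h2.const_mul (t ^ 2)).ofReal (𝕜 := ℂ)).div_const 2
    refine this.congr (.of_forall fun ω ↦ ?_)
    simp [mul_pow]
  have hconst : Integrable (fun ω ↦ (1 : ℂ) + ((t * Y ω : ℝ) : ℂ) * Complex.I) P :=
    (integrable_const _).add hlin
  have hall : Integrable (fun ω ↦ (1 : ℂ) + ((t * Y ω : ℝ) : ℂ) * Complex.I -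
      ((t * Y ω : ℝ) : ℂ) ^ 2 / 2) P := hconst.sub hquad
  have hpoly : ∫ ω, ((1 : ℂ) + ((t * Y ω : ℝ) : ℂ) * Complex.I - ((t * Y ω : ℝ) : ℂ) ^ 2 / 2) ∂P =
      1 - (t : ℂ) ^ 2 * (∫ ω, Y ω ^ 2 ∂P : ℝ) / 2 := by
    rw [integral_sub hconst hquad, integral_add (integrable_const _) hlin,
      integral_mul_const, integral_div, integral_complex_ofReal]
    simp_rw [← Complex.ofReal_pow]
    rw [integral_complex_ofReal]
    simp [integral_const_mul, hmean, mul_pow]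
  rw [charFun_apply_real, integral_map hm (by fun_prop), ← hpoly]
  simp_rw [← Complex.ofReal_mul]
  rw [← integral_sub hexp hall, ← integral_const_mul]
  refine norm_integral_le_of_norm_le (hYp.const_mul _) (.of_forall fun ω ↦ ?_)
  refine (Real.norm_cexp_mul_I_sub_taylor_two_le (t * Y ω) hp2 hp3).trans_eq ?_
  rw [abs_mul, Real.mul_rpow (abs_nonneg _) (abs_nonneg _), mul_assoc]

/-- Write `log (1 + w) = w h(w)` with `h` continuous at `0` and `h(0) = 1`; then `k log (1 + g) = (k
g) h(g) → z`. Using `dslope` for `h` also covers `g n = 0`. -/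
lemma Complex.tendsto_one_add_pow_exp_of_tendsto_mul {ι : Type*} {l : Filter ι} {k : ι → ℕ}
    {g : ι → ℂ} {z : ℂ} (hg : Tendsto g l (𝓝 0)) (hkg : Tendsto (fun n ↦ k n * g n) l (𝓝 z)) :
    Tendsto (fun n ↦ (1 + g n) ^ k n) l (𝓝 (Complex.exp z)) := by
  have hd : HasDerivAt (fun w : ℂ ↦ Complex.log (1 + w)) 1 0 := by
    simpa using ((hasDerivAt_id (0 : ℂ)).const_add 1).clog (by simp)
  have hc : Tendsto (dslope (fun w : ℂ ↦ Complex.log (1 + w)) 0) (𝓝 0) (𝓝 1) := by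
    have := (continuousAt_dslope_same.2 hd.differentiableAt).tendsto
    rwa [dslope_same, hd.deriv] at this
  have hlog (w : ℂ) : Complex.log (1 + w) = w * dslope (fun w : ℂ ↦ Complex.log (1 + w)) 0 w := by
    simpa using (sub_smul_dslope (fun w : ℂ ↦ Complex.log (1 + w)) 0 w).symm
  have hlim := (Complex.continuous_exp.tendsto _).comp (hkg.mul (hc.comp hg))
  rw [mul_one] at hlim
  refine hlim.congr' ?_
  have hne : ∀ᶠ n in l, 1 + g n ≠ 0 := by
    have : Tendsto (fun n ↦ 1 + g n) l (𝓝 (1 + 0)) := hg.const_add 1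
    exact this.eventually_ne (by simp)
  filter_upwards [hne] with n hn
  rw [Function.comp_apply, Function.comp_apply, mul_assoc, ← hlog, Complex.exp_nat_mul,
    Complex.exp_log hn]

/-- **Lyapunov central limit theorem** for triangular arrays with independent, identically
distributed entries in each row. -/
theorem ProbabilityTheory.tendstoInDistribution_sum_of_lyapunov {Ω : Type*} [MeasurableSpace Ω]
    {P : Measure Ω} [IsProbabilityMeasure P] {Y : ℕ → ℕ → Ω → ℝ} {k : ℕ → ℕ}
    (hk : Tendsto k atTop atTop) (hindep : ∀ n, iIndepFun (Y n) P)
    (hident : ∀ n i, IdentDistrib (Y n i) (Y n 0) P P)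
    (hL2 : ∀ n, MemLp (Y n 0) 2 P) (hmean : ∀ n, ∫ ω, Y n 0 ω ∂P = 0)
    {p : ℝ} (hp2 : 2 ≤ p) (hp3 : p ≤ 3) (hLp : ∀ n, Integrable (fun ω ↦ |Y n 0 ω| ^ p) P)
    (hvar : Tendsto (fun n ↦ k n * ∫ ω, Y n 0 ω ^ 2 ∂P) atTop (𝓝 1))
    (hlyap : Tendsto (fun n ↦ k n * ∫ ω, |Y n 0 ω| ^ p ∂P) atTop (𝓝 0)) :
    TendstoInDistribution (fun n ω ↦ ∑ i ∈ Finset.range (k n), Y n i ω) atTop (id : ℝ → ℝ)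
      (fun _ ↦ P) (gaussianReal 0 1) where
  forall_aemeasurable n := Finset.aemeasurable_fun_sum _ fun _ _ ↦ (hident n _).aemeasurable_fst
  tendsto := by
    refine ProbabilityMeasure.tendsto_iff_tendsto_charFun.2 fun t ↦ ?_
    have hchar (n : ℕ) : charFun (P.map (fun ω ↦ ∑ i ∈ Finset.range (k n), Y n i ω)) t =
        (1 + (charFun (P.map (Y n 0)) t - 1)) ^ k n := by
      rw [((hindep n).restrict _).charFun_map_fun_finsetSum_eq_prod
        (fun i _ ↦ (hident n i).aemeasurable_fst)]
      simp [fun i ↦ (hident n i).map_eq]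
    have hmain : Tendsto (fun n ↦ (k n : ℂ) * (charFun (P.map (Y n 0)) t - 1)) atTop
        (𝓝 (-((t : ℂ) ^ 2 / 2))) := by
      have h1 : Tendsto (fun n ↦ -((t : ℂ) ^ 2 / 2 * ((k n * ∫ ω, Y n 0 ω ^ 2 ∂P : ℝ) : ℂ))) atTop
          (𝓝 (-((t : ℂ) ^ 2 / 2))) := by
        simpa using (((Complex.continuous_ofReal.tendsto _).comp hvar).const_mul
          ((t : ℂ) ^ 2 / 2)).neg
      have h2 : Tendsto (fun n ↦ (k n : ℂ) * (charFun (P.map (Y n 0)) t -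
          (1 - t ^ 2 * (∫ ω, Y n 0 ω ^ 2 ∂P : ℝ) / 2))) atTop (𝓝 0) := by
        refine squeeze_zero_norm (fun n ↦ ?_) (by simpa using hlyap.const_mul (4 * |t| ^ p))
        rw [norm_mul, Complex.norm_natCast]
        calc _ ≤ k n * (4 * |t| ^ p * ∫ ω, |Y n 0 ω| ^ p ∂P) := by
              gcongr
              exact norm_charFun_sub_taylor_two_le (hL2 n) (hmean n) hp2 hp3 (hLp n) t
          _ = _ := by ring
      refine ((h2.add h1).congr fun n ↦ ?_).trans_eq (by simp)
      push_cast
      ring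
    have hzero : Tendsto (fun n ↦ charFun (P.map (Y n 0)) t - 1) atTop (𝓝 0) := by
      have hinv : Tendsto (fun n ↦ ((k n : ℂ))⁻¹) atTop (𝓝 0) :=
        (tendsto_inv_atTop_nhds_zero_nat (𝕜 := ℂ)).comp hk
      have := hinv.mul hmain
      rw [zero_mul] at this
      refine this.congr' ?_
      filter_upwards [hk.eventually_gt_atTop 0] with n hn
      have : (k n : ℂ) ≠ 0 := by exact_mod_cast hn.ne'
      field_simp
    have := Complex.tendsto_one_add_pow_exp_of_tendsto_mul hzero hmain
    simp only [ProbabilityMeasure.coe_mk, hchar, Measure.map_id, charFun_gaussianReal]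
    simpa [neg_div] using this

/-- Currying carries the product law of the array to a product over rows of the row laws, so whole
rows are independent. -/
lemma ProbabilityTheory.iIndepFun.curry {Ω ι κ E : Type*} [MeasurableSpace Ω] [MeasurableSpace E]
    {P : Measure Ω} {X : ι → κ → Ω → E} (mX : ∀ i j, Measurable (X i j))
    (h : iIndepFun (fun p : ι × κ ↦ X p.1 p.2) P) : iIndepFun (fun i ω j ↦ X i j ω) P := by
  have := h.isProbabilityMeasure
  have hp (i j) : IsProbabilityMeasure (P.map (X i j)) :=
    Measure.isProbabilityMeasure_map (mX i j).aemeasurable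
  have hrow (i : ι) : iIndepFun (X i) P :=
    h.precomp (g := fun j ↦ (i, j)) (Prod.mk_right_injective i)
  rw [iIndepFun_iff_map_fun_eq_infinitePi_map (by fun_prop)] at h ⊢
  have h' := congrArg (Measure.map (MeasurableEquiv.curry ι κ E)) h
  rw [Measure.infinitePi_map_curry (fun i j ↦ P.map (X i j)),
    Measure.map_map (by fun_prop) (by fun_prop)] at h'
  refine Eq.trans ?_ (h'.trans ?_)
  · rfl
  · congr with i : 1
    exact ((iIndepFun_iff_map_fun_eq_infinitePi_map (by fun_prop)).1 (hrow i)).symm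

/-! ### Moment inequalities and the choice of `p`. -/

lemma Real.abs_sub_rpow_le_add {x a p : ℝ} (hx : 0 ≤ x) (ha : 0 ≤ a) (hp : 0 ≤ p) :
    |x - a| ^ p ≤ x ^ p + a ^ p := by
  have hxp := Real.rpow_nonneg hx p
  have hap := Real.rpow_nonneg ha p
  rcases le_total a x with h | h
  · rw [abs_of_nonneg (sub_nonneg.2 h)]
    linarith [Real.rpow_le_rpow (sub_nonneg.2 h) (sub_le_self x ha) hp]
  · rw [abs_sub_comm, abs_of_nonneg (sub_nonneg.2 h)]
    linarith [Real.rpow_le_rpow (sub_nonneg.2 h) (sub_le_self a hx) hp]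

/-- Centring costs only a factor `2`, because `(E W)^p ≤ E[W^p]` by Jensen. -/
lemma MeasureTheory.integral_abs_sub_integral_rpow_le {Ω : Type*} [MeasurableSpace Ω]
    {P : Measure Ω} [IsProbabilityMeasure P] {W : Ω → ℝ} (hW0 : ∀ ω, 0 ≤ W ω)
    (hW : Integrable W P) {p : ℝ} (hp : 1 ≤ p) (hWp : Integrable (fun ω ↦ W ω ^ p) P) :
    Integrable (fun ω ↦ |W ω - ∫ ω', W ω' ∂P| ^ p) P ∧
      ∫ ω, |W ω - ∫ ω', W ω' ∂P| ^ p ∂P ≤ 2 * ∫ ω, W ω ^ p ∂P := by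
  have hp0 : 0 ≤ p := by linarith
  have ha : 0 ≤ ∫ ω', W ω' ∂P := integral_nonneg hW0
  have hbd (ω : Ω) := Real.abs_sub_rpow_le_add (hW0 ω) ha hp0
  have hsum : Integrable (fun ω ↦ W ω ^ p + (∫ ω', W ω' ∂P) ^ p) P := hWp.add (integrable_const _)
  have hint : Integrable (fun ω ↦ |W ω - ∫ ω', W ω' ∂P| ^ p) P := by
    refine hsum.mono' ?_ (.of_forall fun ω ↦ ?_)
    · exact ((hW.aemeasurable.sub_const _).norm.pow_const p).aestronglyMeasurable
    · rw [Real.norm_of_nonneg (by positivity)]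
      exact hbd ω
  refine ⟨hint, (integral_mono hint hsum hbd).trans ?_⟩
  have hj : (∫ ω, W ω ∂P) ^ p ≤ ∫ ω, W ω ^ p ∂P :=
    (convexOn_rpow hp).map_integral_le (Real.continuous_rpow_const hp0).continuousOn isClosed_Ici
      (.of_forall hW0) hW hWp
  rw [integral_add hWp (integrable_const _)]
  simp
  linarith

/-- The second moment of `exp X` strictly exceeds the squared mean of `exp X` when `X` is
non-degenerate. -/
lemma ProbabilityTheory.sq_mgf_one_lt_mgf_two {Ω : Type*} [MeasurableSpace Ω] {P : Measure Ω}
    [IsProbabilityMeasure P] {X : Ω → ℝ} (hX : Measurable X)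
    (hnd : ∀ a : ℝ, ¬ (∀ᵐ ω ∂P, X ω = a)) (h2 : Integrable (fun ω ↦ Real.exp (2 * X ω)) P) :
    mgf X P 1 ^ 2 < mgf X P 2 := by
  have hsq (ω : Ω) : Real.exp (X ω) ^ 2 = Real.exp (2 * X ω) := by
    rw [← Real.exp_nat_mul]; norm_num
  have hL2 : MemLp (fun ω ↦ Real.exp (X ω)) 2 P := by
    rw [memLp_two_iff_integrable_sq (by fun_prop)]
    simpa only [hsq] using h2
  have hvar : Var[fun ω ↦ Real.exp (X ω); P] = mgf X P 2 - mgf X P 1 ^ 2 := by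
    rw [variance_eq_sub hL2]
    simp [mgf, hsq]
  have hpos : 0 < Var[fun ω ↦ Real.exp (X ω); P] := by
    refine (variance_nonneg _ _).lt_of_ne' fun h0 ↦ ?_
    refine hnd (Real.log (∫ ω, Real.exp (X ω) ∂P)) ?_
    filter_upwards [ae_eq_integral_of_variance_eq_zero hL2 h0] with ω hω
    rw [← hω, Real.log_exp]
  linarith

/-- If the logarithmic growth rate `c` exceeds `2 φ'(2) - φ(2)`, some moment of order slightly
larger than two satisfies the Lyapunov exponent condition. -/
lemma ProbabilityTheory.exists_lyapunov_exponent {Ω : Type*} [MeasurableSpace Ω] {P : Measure Ω}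
    {X : Ω → ℝ} {c : ℝ} (hX : ∀ t : ℝ, 0 ≤ t → Integrable (fun ω ↦ Real.exp (t * X ω)) P)
    (hc : criticalPointTwo X P < c) :
    ∃ p : ℝ, 2 < p ∧ p ≤ 3 ∧ c * (1 - p / 2) + cgf X P p - p / 2 * cgf X P 2 < 0 := by
  have hint : (2 : ℝ) ∈ interior (integrableExpSet X P) :=
    interior_maximal (s := integrableExpSet X P) (t := Set.Ioi 0)
      (fun t ht ↦ hX t (le_of_lt ht)) isOpen_Ioi (Set.mem_Ioi.2 two_pos)
  have hd := (analyticAt_cgf hint).differentiableAt.hasDerivAt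
  have hf : HasDerivAt (fun p ↦ c * (1 - p / 2) + cgf X P p - p / 2 * cgf X P 2)
      (c * (-(1 / 2)) + deriv (cgf X P) 2 - 1 / 2 * cgf X P 2) 2 :=
    (((((hasDerivAt_id (2 : ℝ)).div_const 2).const_sub 1).const_mul c).add hd).sub
      (((hasDerivAt_id (2 : ℝ)).div_const 2).mul_const _)
  have hneg : c * (-(1 / 2)) + deriv (cgf X P) 2 - 1 / 2 * cgf X P 2 < 0 := by
    unfold criticalPointTwo at hc
    linarith
  -- The function vanishes at `2`, so a negative slope from the right makes it negative just above
  -- `2`.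
  have hslope := (hasDerivAt_iff_tendsto_slope.1 hf).mono_left
    (nhdsWithin_mono (2 : ℝ) (s := Set.Ioi 2) fun x hx ↦ ne_of_gt hx)
  obtain ⟨p, hp, hp3, hp2⟩ := ((hslope.eventually_lt_const hneg).and
    (((eventually_le_nhds (show (2 : ℝ) < 3 by norm_num)).filter_mono nhdsWithin_le_nhds).and
      eventually_mem_nhdsWithin)).exists
  refine ⟨p, hp2, hp3, ?_⟩
  rw [slope_def_field, div_lt_iff₀ (sub_pos.2 hp2)] at hp
  norm_num at hp
  linarith

/-! ### Independence, laws and moments of the row products. -/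

section Rows

/-- The `i`-th product of `n` exponentials. -/
noncomputable def rowProduct {Ω : Type*} (Xs : ℕ → ℕ → Ω → ℝ) (n i : ℕ) (ω : Ω) : ℝ :=
  ∏ j ∈ Finset.range n, Real.exp (Xs i j ω)

lemma rowProduct_pos {Ω : Type*} {Xs : ℕ → ℕ → Ω → ℝ} (n i : ℕ) (ω : Ω) : 0 < rowProduct Xs n i ω :=
  Finset.prod_pos fun _ _ ↦ Real.exp_pos _

lemma rowProduct_rpow {Ω : Type*} {Xs : ℕ → ℕ → Ω → ℝ} (n i : ℕ) (t : ℝ) (ω : Ω) :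
    rowProduct Xs n i ω ^ t = Real.exp (t * (∑ j ∈ Finset.range n, Xs i j) ω) := by
  rw [rowProduct, ← Real.exp_sum, ← Real.exp_mul, Finset.sum_apply, mul_comm]

variable {Ω₀ Ω : Type*} [MeasurableSpace Ω₀] [MeasurableSpace Ω]
  {P₀ : Measure Ω₀} {P : Measure Ω} {X : Ω₀ → ℝ} {Xs : ℕ → ℕ → Ω → ℝ}

lemma measurable_rowProduct (hXs : ∀ i j, Measurable (Xs i j)) (n i : ℕ) :
    Measurable (rowProduct Xs n i) :=
  Finset.measurable_prod _ fun _ _ ↦ (hXs _ _).exp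

lemma iIndepFun_row (hindep : iIndepFun (fun p : ℕ × ℕ ↦ Xs p.1 p.2) P) (i : ℕ) :
    iIndepFun (Xs i) P :=
  hindep.precomp (g := fun j ↦ (i, j)) (Prod.mk_right_injective i)

lemma iIndepFun_rowProduct (hXs : ∀ i j, Measurable (Xs i j))
    (hindep : iIndepFun (fun p : ℕ × ℕ ↦ Xs p.1 p.2) P) (n : ℕ) :
    iIndepFun (rowProduct Xs n) P :=
  (hindep.curry hXs).comp (fun _ x ↦ ∏ j ∈ Finset.range n, Real.exp (x j)) fun _ ↦ by fun_prop

lemma identDistrib_rowProduct (hindep : iIndepFun (fun p : ℕ × ℕ ↦ Xs p.1 p.2) P)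
    (hident : ∀ i j, IdentDistrib (Xs i j) X P P₀) (n i : ℕ) :
    IdentDistrib (rowProduct Xs n i) (rowProduct Xs n 0) P P :=
  (IdentDistrib.pi (fun j ↦ (hident i j).trans (hident 0 j).symm) (iIndepFun_row hindep i)
    (iIndepFun_row hindep 0)).comp (u := fun x : ℕ → ℝ ↦ ∏ j ∈ Finset.range n, Real.exp (x j)) (by fun_prop)

lemma integrable_rowProduct_rpow (hXs : ∀ i j, Measurable (Xs i j))
    (hindep : iIndepFun (fun p : ℕ × ℕ ↦ Xs p.1 p.2) P)
    (hident : ∀ i j, IdentDistrib (Xs i j) X P P₀) {t : ℝ}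
    (ht : Integrable (fun ω ↦ Real.exp (t * X ω)) P₀) (n i : ℕ) :
    Integrable (fun ω ↦ rowProduct Xs n i ω ^ t) P := by
  have := hindep.isProbabilityMeasure
  simp_rw [rowProduct_rpow]
  refine (iIndepFun_row hindep i).integrable_exp_mul_sum (hXs i) fun j _ ↦ ?_
  exact ((hident i j).comp (u := fun x ↦ Real.exp (t * x)) (by fun_prop)).integrable_iff.2 ht

lemma integral_rowProduct_rpow (hXs : ∀ i j, Measurable (Xs i j))
    (hindep : iIndepFun (fun p : ℕ × ℕ ↦ Xs p.1 p.2) P)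
    (hident : ∀ i j, IdentDistrib (Xs i j) X P P₀) (t : ℝ) (n i : ℕ) :
    ∫ ω, rowProduct Xs n i ω ^ t ∂P = mgf X P₀ t ^ n := by
  simp_rw [rowProduct_rpow]
  refine ((iIndepFun_row hindep i).mgf_sum (hXs i) (Finset.range n)).trans ?_
  simp [fun j ↦ congrFun (mgf_congr_identDistrib (hident i j)) t]

end Rows

/-! ### The main theorem. -/

theorem theorem1
    {Ω₀ Ω : Type*} [MeasurableSpace Ω₀] [MeasurableSpace Ω]
    (P₀ : Measure Ω₀) [IsProbabilityMeasure P₀]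
    (P : Measure Ω) [IsProbabilityMeasure P]
    -- the random variable `X`: non-degenerate, with `φ(t)` finite for all `t ≥ 0`
    (X : Ω₀ → ℝ) (hX : Measurable X)
    (hX_nondeg : ∀ a : ℝ, ¬ (∀ᵐ ω ∂P₀, X ω = a))
    (hX_exp : ∀ t : ℝ, 0 ≤ t → Integrable (fun ω => Real.exp (t * X ω)) P₀)
    -- the array of independent copies of `X`
    (Xs : ℕ → ℕ → Ω → ℝ) (hXs : ∀ i j, Measurable (Xs i j))
    (hXs_indep : iIndepFun (fun p : ℕ × ℕ => Xs p.1 p.2) P)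
    (hXs_ident : ∀ i j, IdentDistrib (Xs i j) X P P₀)
    -- the numbers of summands
    (c : ℝ) (hc : 0 < c) (N : ℕ → ℕ)
    (hN : Tendsto (fun n : ℕ => Real.exp (-c * n) * (N n : ℝ)) atTop (𝓝 1))
    (hc_two : criticalPointTwo X P₀ < c) :
    (∀ n, MemLp (sumOfProducts Xs N n) 2 P) ∧
    (∀ᶠ n in atTop, 0 < Var[sumOfProducts Xs N n; P]) ∧
    TendstoInDistribution
      (fun (n : ℕ) (ω : Ω) =>
        (sumOfProducts Xs N n ω - ∫ ω', sumOfProducts Xs N n ω' ∂P) /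
          √(Var[sumOfProducts Xs N n; P]))
      atTop (id : ℝ → ℝ) (fun _ => P) (gaussianReal 0 1) := by
  have hmoment_int {t : ℝ} (ht : 0 ≤ t) (n i : ℕ) :=
    integrable_rowProduct_rpow hXs hXs_indep hXs_ident (hX_exp t ht) n i
  have hmoment := integral_rowProduct_rpow hXs hXs_indep hXs_ident
  have hW_meas := measurable_rowProduct hXs
  have hW_indep := iIndepFun_rowProduct hXs hXs_indep
  have hW_ident := identDistrib_rowProduct hXs_indep hXs_ident
  have hW_L2 (n i : ℕ) : MemLp (rowProduct Xs n i) 2 P := by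
    rw [memLp_two_iff_integrable_sq (hW_meas n i).aestronglyMeasurable]
    simpa using hmoment_int zero_le_two n i
  have hW_int (n i : ℕ) : Integrable (rowProduct Xs n i) P := (hW_L2 n i).integrable (by norm_num)
  have hZ (n : ℕ) : sumOfProducts Xs N n = ∑ i ∈ Finset.range (N n), rowProduct Xs n i := by
    ext ω; simp [sumOfProducts, rowProduct]
  have hZ_L2 (n : ℕ) : MemLp (sumOfProducts Xs N n) 2 P := by
    rw [hZ]
    exact memLp_finsetSum' _ fun i _ ↦ hW_L2 n i
  have hm2 : 0 < mgf X P₀ 2 := mgf_pos (hX_exp 2 zero_le_two)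
  have hlt := sq_mgf_one_lt_mgf_two hX hX_nondeg (hX_exp 2 zero_le_two)
  set v : ℕ → ℝ := fun n ↦ Var[rowProduct Xs n 0; P] with hv
  have hv_eq (n : ℕ) : v n = mgf X P₀ 2 ^ n - (mgf X P₀ 1 ^ 2) ^ n := by
    rw [hv]
    dsimp only
    rw [variance_eq_sub (hW_L2 n 0)]
    have h2 := hmoment 2 n 0
    have h1 := hmoment 1 n 0
    simp only [Real.rpow_two, Real.rpow_one] at h1 h2
    simp only [Pi.pow_apply, h1, h2]
    ring
  -- For `n = 0` the product is empty and the variance is `0`.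
  have hv_pos {n : ℕ} (hn : 0 < n) : 0 < v n := by
    rw [hv_eq, sub_pos]
    exact pow_lt_pow_left₀ hlt (sq_nonneg _) hn.ne'
  have hZ_var (n : ℕ) : Var[sumOfProducts Xs N n; P] = N n * v n := by
    rw [hZ, IndepFun.variance_sum (fun i _ ↦ hW_L2 n i)
      (fun i _ j _ hij ↦ (hW_indep n).indepFun hij)]
    simp [fun i ↦ (hW_ident n i).variance_eq, hv]
  have hZ_mean (n : ℕ) : ∫ ω, sumOfProducts Xs N n ω ∂P = N n * ∫ ω, rowProduct Xs n 0 ω ∂P := by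
    rw [hZ]
    simp only [Finset.sum_apply]
    rw [integral_finsetSum _ fun i _ ↦ hW_int n i]
    simp [fun i ↦ (hW_ident n i).integral_eq]
  have hexp_top : Tendsto (fun n : ℕ ↦ Real.exp (c * n)) atTop atTop :=
    Real.tendsto_exp_atTop.comp (tendsto_natCast_atTop_atTop.const_mul_atTop hc)
  have hN_top : Tendsto N atTop atTop := by
    rw [← tendsto_natCast_atTop_iff (R := ℝ)]
    refine (hexp_top.atTop_mul_pos one_pos hN).congr fun n ↦ ?_
    rw [← mul_assoc, ← Real.exp_add]
    simp
  have hZ_pos : ∀ᶠ n in atTop, 0 < N n * v n := by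
    filter_upwards [hN_top.eventually_gt_atTop 0, eventually_gt_atTop 0] with n hn hn0
    exact mul_pos (by exact_mod_cast hn) (hv_pos hn0)
  refine ⟨hZ_L2, by simpa only [hZ_var] using hZ_pos, ?_⟩
  obtain ⟨p, hp2, hp3, hp⟩ := exists_lyapunov_exponent hX_exp hc_two
  have hp0 : 0 < p := by linarith
  have habs (n : ℕ) := integral_abs_sub_integral_rpow_le (fun ω ↦ (rowProduct_pos n 0 ω).le)
    (hW_int n 0) (by linarith) (hmoment_int hp0.le n 0)
  have hcent (n : ℕ) (ω : Ω) :
      |(rowProduct Xs n 0 ω - ∫ ω', rowProduct Xs n 0 ω' ∂P) / √(N n * v n)| ^ p =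
        |rowProduct Xs n 0 ω - ∫ ω', rowProduct Xs n 0 ω' ∂P| ^ p / √(N n * v n) ^ p := by
    rw [abs_div, abs_of_nonneg (Real.sqrt_nonneg _),
      Real.div_rpow (abs_nonneg _) (Real.sqrt_nonneg _)]
  have key := tendstoInDistribution_sum_of_lyapunov (P := P) (k := N)
    (Y := fun n i ω ↦ (rowProduct Xs n i ω - ∫ ω', rowProduct Xs n 0 ω' ∂P) / √(N n * v n))
    hN_top
    (fun n ↦ (hW_indep n).comp
      (fun _ x ↦ (x - ∫ ω', rowProduct Xs n 0 ω' ∂P) / √(N n * v n)) fun _ ↦ by fun_prop)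
    (fun n i ↦ (hW_ident n i).comp
      (u := fun x ↦ (x - ∫ ω', rowProduct Xs n 0 ω' ∂P) / √(N n * v n)) (by fun_prop))
    (fun n ↦ by
      have h : MemLp (fun ω ↦ rowProduct Xs n 0 ω - ∫ ω', rowProduct Xs n 0 ω' ∂P) 2 P :=
        (hW_L2 n 0).sub (memLp_const _)
      simpa only [div_eq_mul_inv] using h.mul_const _)
    (fun n ↦ by
      rw [integral_div, integral_sub (hW_int n 0) (integrable_const _)]
      simp)
    hp2.le hp3
    (fun n ↦ by
      simp only [hcent]
      exact (habs n).1.div_const _)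
    ?_ ?_
  · convert! key using 3 with n ω
    rw [hZ_mean, hZ_var, hZ, Finset.sum_apply, ← Finset.sum_div, Finset.sum_sub_distrib]
    simp
  · refine tendsto_const_nhds.congr' ?_
    filter_upwards [hZ_pos] with n hn
    simp only [div_pow]
    rw [integral_div, Real.sq_sqrt hn.le, ← variance_eq_integral (hW_meas n 0).aemeasurable]
    change 1 = N n * (v n / (N n * v n))
    rw [← mul_div_assoc, div_self hn.ne']
  · have hratio : Tendsto (fun n ↦ v n / mgf X P₀ 2 ^ n) atTop (𝓝 1) := by
      have h := (tendsto_pow_atTop_nhds_zero_of_lt_one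
        (div_nonneg (sq_nonneg (mgf X P₀ 1)) hm2.le) ((div_lt_one hm2).2 hlt)).const_sub 1
      rw [sub_zero] at h
      refine h.congr fun n ↦ ?_
      rw [hv_eq, div_pow, sub_div, div_self (pow_pos hm2 n).ne']
    have hgeom : Tendsto (fun n : ℕ ↦
        Real.exp (n * (c * (1 - p / 2) + cgf X P₀ p - p / 2 * cgf X P₀ 2))) atTop (𝓝 0) :=
      Real.tendsto_exp_atBot.comp (tendsto_natCast_atTop_atTop.atTop_mul_const_of_neg hp)
    -- This is `2 N E[W^p] / (N v)^(p/2)`, regrouped so that two factors tend to `1` and the third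
    -- decays geometrically.
    have hlim : Tendsto (fun n : ℕ ↦ 2 * ((Real.exp (-c * n) * N n) ^ (1 - p / 2) *
        (v n / mgf X P₀ 2 ^ n) ^ (-(p / 2)) *
        Real.exp (n * (c * (1 - p / 2) + cgf X P₀ p - p / 2 * cgf X P₀ 2)))) atTop (𝓝 0) := by
      simpa using (((hN.rpow_const (p := 1 - p / 2) (.inl one_ne_zero)).mul
        (hratio.rpow_const (p := -(p / 2)) (.inl one_ne_zero))).mul hgeom).const_mul 2
    refine squeeze_zero' (.of_forall fun n ↦ ?_) ?_ hlim
    · exact mul_nonneg (Nat.cast_nonneg _) (integral_nonneg fun ω ↦ by positivity)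
    filter_upwards [hN_top.eventually_gt_atTop 0, eventually_gt_atTop 0] with n hn hn0
    have hNpos : (0 : ℝ) < N n := by exact_mod_cast hn
    have hvpos := hv_pos hn0
    have hmp : 0 < mgf X P₀ p := mgf_pos (hX_exp p hp0.le)
    simp only [hcent]
    rw [integral_div]
    calc _ ≤ N n * (2 * mgf X P₀ p ^ n / √(N n * v n) ^ p) := by
          gcongr
          exact (habs n).2.trans_eq (by rw [hmoment])
      _ = _ := by
          rw [Real.sqrt_eq_rpow, ← Real.rpow_mul (by positivity)]
          -- All quantities are positive; written as exponentials, the identity reduces to `ring` on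
          -- exponents.
          have e1 : (N n : ℝ) = Real.exp (Real.log (N n)) := (Real.exp_log hNpos).symm
          have e2 : v n = Real.exp (Real.log (v n)) := (Real.exp_log hvpos).symm
          have e3 : mgf X P₀ p ^ n = Real.exp (n * cgf X P₀ p) := by
            rw [Real.exp_nat_mul, cgf, Real.exp_log hmp]
          have e4 : mgf X P₀ 2 ^ n = Real.exp (n * cgf X P₀ 2) := by
            rw [Real.exp_nat_mul, cgf, Real.exp_log hm2]
          rw [e3, e4, e1, e2]
          generalize Real.log (N n) = a, Real.log (v n) = b
          simp only [← Real.exp_add, ← Real.exp_sub, ← Real.exp_mul, mul_div_assoc,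
            mul_left_comm _ (2 : ℝ)]
          congr 2
          ring
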